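/- Let $n,k$ be natural numbers. Matrix data $c=(A,B,C,D,L,Q,R)$, with $A,C,Q\in\mathbb R^{n\times n}$, $B,D\in\mathbb R^{n\times k}$, $L\in\mathbb R^{k\times n}$, $R\in\mathbb R^{k\times k}$, are called admissible if $\begin{pmatrix}Q&L'\\L&R\end{pmatrix}$ is symmetric positive semidefinite and $\ker R\cap\ker D=\{0\}$. The generalized Riccati differential equation (GRDE) with data $c$, possibly depending continuously on time, is the equation $$\dot P=\phi(P)=A'P+PA+C'PC+Q-(B'P+D'PC+L)'(R+D'PD)^{-1}(B'P+D'PC+L)$$ on positive definite $n\times n$ matrices; $M_s^t(G)$ denotes the value at time $t\ge s$ of its solution with value $G$ at time $s$, defined as long as this solution exists and stays positive definite. A symmetric gauge function is a convex function $\nu:\mathbb R^n\to\mathbb R$, positively homogeneous of degree one, such that $\nu(\lambda_1,\dots,\lambda_n)=\nu(|\lambda_{\sigma(1)}|,\dots,|\lambda_{\sigma(n)}|)$ for every $\lambda\in\mathbb R^n$ and every permutation $\sigma$. For a symmetric matrix $S$ with vector of eigenvalues $\lambda(S)$ put $\hat\nu(S)=\nu(\lambda(S))$, and for positive definite $P_1,P_2$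 put $d_\nu(P_1,P_2)=\hat\nu\big(\log(P_1^{-1/2}P_2P_1^{-1/2})\big)$. The flow is non-expansive in $d_\nu$ if $d_\nu(M_s^t(G_1),M_s^t(G_2))\le d_\nu(G_1,G_2)$ for all positive definite $G_1,G_2$ and all times $s\le t$ (in the time interval on which the data are given) for which both sides are defined. Theorem. For every symmetric gauge function $\nu$ on $\mathbb R^n$, the following are equivalent: (i) for every $T>0$ and all admissible data that depend continuously on $t\in[0,T]$, the flow of the GRDE on $[0,T]$ is non-expansive in $d_\nu$; (ii) for all constant admissible data, the flow of the GRDE on $[0,\infty)$ is non-expansive in $d_\nu$; (iii) $\nu$ is a scalar multiple of the sup-norm, i.e. there is $a\ge 0$ with $\nu(\lambda)=a\max_i|\lambda_i|$ for all $\lambda\in\mathbb R^n$. In particular, if $n\ge 2$, there are constant admissible data for which the flow of the GRDE is not non-expansive in the invariant Riemannian metric, i.e. in $d_\nu$ with $\nu(\lambda)=(\sum_i\lambda_i^2)^{1/2}$. -/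

import Mathlib

open Set

namespace GRDE

/-- A symmetric gauge function on `ℝⁿ`: a convex, positively homogeneous function of degree one
that is invariant under permutations and sign changes of the coordinates. -/
structure IsSymmetricGauge {n : ℕ} (ν : (Fin n → ℝ) → ℝ) : Prop where
  convex : ConvexOn ℝ univ ν
  pos_homogeneous : ∀ (r : ℝ) (x : Fin n → ℝ), 0 < r → ν (r • x) = r * ν x
  symmetric : ∀ (σ : Equiv.Perm (Fin n)) (x : Fin n → ℝ), ν x = ν (fun i => |x (σ i)|)

/-- The function `ν̂` on symmetric matrices, `ν̂ S = ν (λ S)`, where `λ S` is the vector of the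
eigenvalues of `S` counted with multiplicity (the value at a matrix that is not symmetric is
irrelevant). -/
noncomputable def spectralFn {n : ℕ} (ν : (Fin n → ℝ) → ℝ) (S : Matrix (Fin n) (Fin n) ℝ) : ℝ :=
  open Classical in if h : S.IsHermitian then ν h.eigenvalues else 0

/-- `P^{-1/2}`, through the continuous functional calculus of symmetric matrices. -/
noncomputable def invSqrt {n : ℕ} (P : Matrix (Fin n) (Fin n) ℝ) : Matrix (Fin n) (Fin n) ℝ :=
  (cfc Real.sqrt P)⁻¹

/-- The logarithm of a positive definite matrix. -/
noncomputable def matLog {n : ℕ} (P : Matrix (Fin n) (Fin n) ℝ) : Matrix (Fin n) (Fin n) ℝ :=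
  cfc Real.log P

/-- The invariant Finsler metric `d_ν(P, Q) = ν̂ (log (P^{-1/2} Q P^{-1/2}))` on positive definite
matrices. -/
noncomputable def finslerDist {n : ℕ} (ν : (Fin n → ℝ) → ℝ) (P Q : Matrix (Fin n) (Fin n) ℝ) : ℝ :=
  spectralFn ν (matLog (invSqrt P * Q * invSqrt P))

/-- The Euclidean norm on `ℝⁿ`; its metric `finslerDist euclideanGauge` is the invariant
Riemannian metric on positive definite matrices. -/
noncomputable def euclideanGauge {n : ℕ} (x : Fin n → ℝ) : ℝ :=
  Real.sqrt (∑ i, x i ^ 2)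

/-- The matrix data `(A, B, C, D, L, Q, R)` of a generalized Riccati differential equation with
state dimension `n` and control dimension `k`. -/
structure Coeffs (n k : ℕ) where
  A : Matrix (Fin n) (Fin n) ℝ
  B : Matrix (Fin n) (Fin k) ℝ
  C : Matrix (Fin n) (Fin n) ℝ
  D : Matrix (Fin n) (Fin k) ℝ
  L : Matrix (Fin k) (Fin n) ℝ
  Q : Matrix (Fin n) (Fin n) ℝ
  R : Matrix (Fin k) (Fin k) ℝ

/-- Admissible data: the block matrix `[Q, Lᵀ; L, R]` is (symmetric) positive semidefinite and
`ker R ∩ ker D = {0}`. -/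
def Coeffs.Admissible {n k : ℕ} (c : Coeffs n k) : Prop :=
  (Matrix.fromBlocks c.Q c.L.transpose c.L c.R).PosSemidef ∧
    ∀ u : Fin k → ℝ, c.R.mulVec u = 0 → c.D.mulVec u = 0 → u = 0

/-- The right-hand side of the generalized Riccati differential equation. -/
noncomputable def Coeffs.phi {n k : ℕ} (c : Coeffs n k) (P : Matrix (Fin n) (Fin n) ℝ) :
    Matrix (Fin n) (Fin n) ℝ :=
  c.A.transpose * P + P * c.A + c.C.transpose * P * c.C + c.Q -
    (c.B.transpose * P + c.D.transpose * P * c.C + c.L).transpose *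
      (c.R + c.D.transpose * P * c.D)⁻¹ *
      (c.B.transpose * P + c.D.transpose * P * c.C + c.L)

/-- Time-dependent data that are continuous on `J`. -/
structure ContinuousData {n k : ℕ} (c : ℝ → Coeffs n k) (J : Set ℝ) : Prop where
  contA : ContinuousOn (fun t => (c t).A) J
  contB : ContinuousOn (fun t => (c t).B) J
  contC : ContinuousOn (fun t => (c t).C) J
  contD : ContinuousOn (fun t => (c t).D) J
  contL : ContinuousOn (fun t => (c t).L) J
  contQ : ContinuousOn (fun t => (c t).Q) J
  contR : ContinuousOn (fun t => (c t).R) J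

/-- `X` solves `Ẋ = φ(τ, X)` on `[s, t]` and takes positive definite values there. -/
def IsTrajectory {n k : ℕ} (c : ℝ → Coeffs n k) (s t : ℝ)
    (X : ℝ → Matrix (Fin n) (Fin n) ℝ) : Prop :=
  ∀ τ ∈ Icc s t, (X τ).PosDef ∧
    ∀ i j, HasDerivWithinAt (fun r => X r i j) ((c τ).phi (X τ) i j) (Icc s t) τ

/-- The graph of the (partially defined) flow `M_s^t` of the equation on the positive definite
matrices: the trajectory that starts from `G` at time `s` stays positive definite up to time `t`,
where it equals `P`. -/
def FlowsTo {n k : ℕ} (c : ℝ → Coeffs n k) (s t : ℝ) (G P : Matrix (Fin n) (Fin n) ℝ) : Prop :=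
  ∃ X : ℝ → Matrix (Fin n) (Fin n) ℝ, IsTrajectory c s t X ∧ X s = G ∧ X t = P

/-- The flow with data `c` on the time set `J` is non-expansive for `d`:
`d (M_s^t(G₁), M_s^t(G₂)) ≤ d (G₁, G₂)` whenever `s ≤ t` in `J` and both sides are defined. -/
def NonExpansive {n k : ℕ}
    (d : Matrix (Fin n) (Fin n) ℝ → Matrix (Fin n) (Fin n) ℝ → ℝ)
    (c : ℝ → Coeffs n k) (J : Set ℝ) : Prop :=
  ∀ s ∈ J, ∀ t ∈ J, s ≤ t → ∀ G₁ G₂ P₁ P₂ : Matrix (Fin n) (Fin n) ℝ,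
    FlowsTo c s t G₁ P₁ → FlowsTo c s t G₂ P₂ → d P₁ P₂ ≤ d G₁ G₂

end GRDE

/-! For the sup-norm, `finslerDist` is the Thompson metric: distance at most `α` means `e^{-α} P ≤ Q
≤ e^α P` as quadratic forms (`finslerDist_norm_le_iff`). The form of `φ(P)` is a minimum over
controls of a Hamiltonian that is a part linear and, in the second-order term, monotone in `P`, plus
a nonnegative cost (`hamiltonian_eq`). So where `Y ≤ μ X` becomes an equality in a direction and `1
≤ μ`, `φ` does not break the bound there (`phi_le_smul_phi`). Bounds of this kind therefore
propagate (`IsTrajectory.le_smul`), which gives non-expansiveness.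

Conversely, the equation `Ṗ = P j j • E i i` copies a discrepancy in entry `j` into entry `i`
without losing it in `j`. Non-expansiveness then bounds `ν` of an indicator by `ν` of a smaller
nonempty one (`indicator_insert_le`), hence `ν (1, …, 1)` by `ν` of a unit vector. Monotonicity
squeezes `ν` to a multiple of the sup-norm. The Euclidean norm is no such multiple when `2 ≤ n`. -/

namespace GRDE

open Matrix

/-! ### Symmetric gauge functions -/

namespace IsSymmetricGauge

variable {n : ℕ} {ν : (Fin n → ℝ) → ℝ}

theorem map_abs (h : IsSymmetricGauge ν) (x : Fin n → ℝ) : ν (fun i => |x i|) = ν x :=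
  (h.symmetric (Equiv.refl _) x).symm

theorem map_perm (h : IsSymmetricGauge ν) (σ : Equiv.Perm (Fin n)) (x : Fin n → ℝ) :
    ν (x ∘ σ) = ν x := by
  rw [h.symmetric σ x, ← h.map_abs (x ∘ σ)]
  rfl

theorem map_zero (h : IsSymmetricGauge ν) : ν 0 = 0 := by
  have := h.pos_homogeneous 2 0 two_pos
  rw [smul_zero] at this
  linarith

theorem map_smul (h : IsSymmetricGauge ν) {r : ℝ} (hr : 0 ≤ r) (x : Fin n → ℝ) :
    ν (r • x) = r * ν x := by
  rcases hr.eq_or_lt with rfl | hr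
  · simp [h.map_zero]
  · exact h.pos_homogeneous r x hr

/-- The point `x` lies in the box with vertices `(±y i)`. A convex function on the box is dominated
by its value at some vertex, and sign invariance gives all vertices the value `ν y`. -/
theorem mono (h : IsSymmetricGauge ν) {x y : Fin n → ℝ} (hxy : ∀ i, |x i| ≤ y i) :
    ν x ≤ ν y := by
  have hx : x ∈ convexHull ℝ (univ.pi fun i => ({-y i, y i} : Set ℝ)) := by
    rw [convexHull_pi]
    intro i _
    have hi := hxy i
    change x i ∈ convexHull ℝ _
    rw [convexHull_pair, segment_eq_Icc (by linarith [abs_nonneg (x i)])]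
    exact abs_le.1 hi
  obtain ⟨z, hz, hxz⟩ := h.convex.exists_ge_of_mem_convexHull (subset_univ _) hx
  refine hxz.trans_eq ?_
  rw [← h.map_abs z, ← h.map_abs y]
  congr 1
  funext i
  rcases hz i (mem_univ i) with hi | hi
  · rw [hi, abs_neg]
  · rw [mem_singleton_iff.1 hi]

theorem nonneg (h : IsSymmetricGauge ν) (x : Fin n → ℝ) : 0 ≤ ν x := by
  rw [← h.map_abs x, ← h.map_zero]
  exact h.mono fun i => by simp

/-- A symmetric gauge that takes the same value at `(1, …, 1)` and at the first unit vectors is a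
multiple of the sup-norm. -/
theorem eq_smul_norm (h : IsSymmetricGauge ν)
    (h1 : ∀ j, ν (fun _ => 1) ≤ ν (Pi.single j 1)) :
    ∃ a : ℝ, 0 ≤ a ∧ ∀ x : Fin n → ℝ, ν x = a * ‖x‖ := by
  refine ⟨ν (fun _ => 1), h.nonneg _, fun x => le_antisymm ?_ ?_⟩
  · rw [mul_comm, ← h.map_smul (norm_nonneg x)]
    exact h.mono fun i => by simpa using norm_le_pi_norm x i
  · rcases isEmpty_or_nonempty (Fin n) with he | he
    · rw [Subsingleton.elim x 0, norm_zero, mul_zero, h.map_zero]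
    obtain ⟨i, hi⟩ := Finite.exists_max fun i => ‖x i‖
    have hn : ‖x‖ = |x i| :=
      le_antisymm ((pi_norm_le_iff_of_nonneg (abs_nonneg _)).2 hi) (norm_le_pi_norm x i)
    calc ν (fun _ => 1) * ‖x‖ ≤ ν (Pi.single i 1) * ‖x‖ :=
          mul_le_mul_of_nonneg_right (h1 i) (norm_nonneg x)
      _ = ν (‖x‖ • Pi.single i 1) := by rw [h.map_smul (norm_nonneg x), mul_comm]
      _ ≤ ν (fun l => |x l|) := h.mono fun l => by
          by_cases hl : l = i
          · subst hl; simp [hn]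
          · simp [hl]
      _ = ν x := h.map_abs x

end IsSymmetricGauge

theorem isSymmetricGauge_euclideanGauge (n : ℕ) :
    IsSymmetricGauge (euclideanGauge : (Fin n → ℝ) → ℝ) := by
  have hnorm : ∀ x : Fin n → ℝ, euclideanGauge x = ‖WithLp.toLp 2 x‖ := fun x => by
    simp [euclideanGauge, EuclideanSpace.norm_eq]
  refine ⟨⟨convex_univ, fun x _ y _ a b ha hb _ => ?_⟩, fun r x hr => ?_, fun σ x => ?_⟩
  · simp only [hnorm, WithLp.toLp_add, WithLp.toLp_smul]
    refine (norm_add_le _ _).trans_eq ?_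
    simp [norm_smul, abs_of_nonneg, ha, hb]
  · simp [hnorm, WithLp.toLp_smul, norm_smul, abs_of_pos hr]
  · simp only [euclideanGauge, sq_abs]
    rw [Equiv.sum_comp σ fun i => x i ^ 2]

theorem euclideanGauge_ne_smul_norm {n : ℕ} (hn : 2 ≤ n) :
    ¬ ∃ a : ℝ, 0 ≤ a ∧ ∀ x : Fin n → ℝ, euclideanGauge x = a * ‖x‖ := by
  rintro ⟨a, -, ha⟩
  have : Nonempty (Fin n) := ⟨⟨0, by omega⟩⟩
  have h0 := ha (Pi.single ⟨0, by omega⟩ 1)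
  have h1 := ha fun _ => 1
  have e0 : euclideanGauge (Pi.single (⟨0, by omega⟩ : Fin n) (1 : ℝ)) = 1 := by
    rw [euclideanGauge, Finset.sum_eq_single ⟨0, by omega⟩] <;> simp +contextual
  rw [e0, Pi.norm_single, norm_one, mul_one] at h0
  rw [pi_norm_const, ← h0, norm_one, euclideanGauge, mul_one, Real.sqrt_eq_one] at h1
  have : n = 1 := by exact_mod_cast (by simpa using h1 : (n : ℝ) = 1)
  omega

/-! ### The metric on diagonal matrices -/

variable {n k : ℕ}

/-- On the finite spectrum `f` agrees with a Lagrange interpolant, and polynomials commute with the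
algebra homomorphism `diagonal`. -/
theorem cfc_diagonal (f : ℝ → ℝ) (d : Fin n → ℝ) :
    cfc f (diagonal d) = diagonal (f ∘ d) := by
  have hd : IsSelfAdjoint (diagonal d) := isHermitian_diagonal d
  let p := Lagrange.interpolate (Finset.univ.image d) id f
  have hp : ∀ i, p.eval (d i) = f (d i) := fun i =>
    Lagrange.eval_interpolate_at_node (v := id) f Function.injective_id.injOn
      (Finset.mem_image_of_mem d (Finset.mem_univ i))
  have h1 : cfc f (diagonal d) = cfc (fun x => p.eval x) (diagonal d) := by
    refine cfc_congr fun x hx => ?_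
    rw [spectrum_diagonal] at hx
    obtain ⟨i, rfl⟩ := hx
    exact (hp i).symm
  rw [h1, cfc_polynomial p _ hd]
  change Polynomial.aeval (diagonalAlgHom ℝ d) p = _
  rw [Polynomial.aeval_algHom_apply]
  simp only [diagonalAlgHom_apply]
  congr 1
  funext i
  rw [Polynomial.aeval_pi_apply]
  simp [hp]

theorem exists_perm_of_map_univ_eq {f g : Fin n → ℝ}
    (h : Multiset.map f Finset.univ.val = Multiset.map g Finset.univ.val) :
    ∃ σ : Equiv.Perm (Fin n), g ∘ σ = f := by
  have hc : ∀ c, Nonempty ({i // f i = c} ≃ {i // g i = c}) := fun c => by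
    have := congrArg (Multiset.count c) h
    rw [Multiset.count_map, Multiset.count_map] at this
    refine ⟨Fintype.equivOfCardEq ?_⟩
    simp only [Fintype.card_subtype, eq_comm (b := c)]
    exact this
  have e := fun c => (hc c).some
  exact ⟨Equiv.ofFiberEquiv e, funext fun i => Equiv.ofFiberEquiv_map e i⟩

/-- Both `d` and the sorted eigenvalues list the roots of the characteristic polynomial, so they
differ by a permutation. -/
theorem IsSymmetricGauge.spectralFn_diagonal {ν : (Fin n → ℝ) → ℝ} (h : IsSymmetricGauge ν)
    (d : Fin n → ℝ) : spectralFn ν (diagonal d) = ν d := by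
  have hd : (diagonal d).IsHermitian := isHermitian_diagonal d
  rw [spectralFn, dif_pos hd]
  have hr := hd.roots_charpoly_eq_eigenvalues
  have hf : (fun i => Polynomial.X - Polynomial.C (d i)) =
      (fun a => Polynomial.X - Polynomial.C a) ∘ d := rfl
  rw [charpoly_diagonal, Finset.prod, hf,
    ← Multiset.map_map (fun a => Polynomial.X - Polynomial.C a) d,
    Polynomial.roots_multiset_prod_X_sub_C] at hr
  obtain ⟨σ, hσ⟩ := exists_perm_of_map_univ_eq hr
  exact (h.map_perm σ hd.eigenvalues).symm.trans (congrArg ν hσ)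

theorem IsSymmetricGauge.finslerDist_diagonal {ν : (Fin n → ℝ) → ℝ} (h : IsSymmetricGauge ν)
    {p : Fin n → ℝ} (hp : ∀ i, 0 < p i) (q : Fin n → ℝ) :
    finslerDist ν (diagonal p) (diagonal q) = ν fun i => Real.log (q i / p i) := by
  have hi : invSqrt (diagonal p) = diagonal fun i => (√(p i))⁻¹ := by
    rw [invSqrt, cfc_diagonal]
    refine inv_eq_left_inv ?_
    rw [diagonal_mul_diagonal, ← diagonal_one]
    congr 1
    funext i
    exact inv_mul_cancel₀ (Real.sqrt_pos.2 (hp i)).ne'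
  rw [finslerDist, hi, diagonal_mul_diagonal, diagonal_mul_diagonal, matLog, cfc_diagonal,
    h.spectralFn_diagonal]
  congr 1
  funext i
  have := Real.mul_self_sqrt (hp i).le
  simp only [Function.comp]
  congr 1
  rw [mul_comm, ← mul_assoc, ← mul_inv, this, inv_mul_eq_div]

/-! ### The sup-norm metric as the Thompson metric -/

theorem spectralFn_norm_le_iff {S : Matrix (Fin n) (Fin n) ℝ} (hS : S.IsHermitian) {α : ℝ}
    (hα : 0 ≤ α) :
    spectralFn (fun x => ‖x‖) S ≤ α ↔ ∀ x ∈ spectrum ℝ S, |x| ≤ α := by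
  rw [spectralFn, dif_pos hS, pi_norm_le_iff_of_nonneg hα, hS.spectrum_real_eq_range_eigenvalues,
    forall_mem_range]
  rfl

open scoped MatrixOrder in
-- Both sides express `a • 1 ≤ S ≤ b • 1` in the Loewner order.
theorem spectrum_bounds_iff {S : Matrix (Fin n) (Fin n) ℝ} (hS : S.IsHermitian) (a b : ℝ) :
    (∀ x ∈ spectrum ℝ S, a ≤ x ∧ x ≤ b) ↔
      ∀ v, a * (v ⬝ᵥ v) ≤ v ⬝ᵥ S *ᵥ v ∧ v ⬝ᵥ S *ᵥ v ≤ b * (v ⬝ᵥ v) := by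
  have hS' : IsSelfAdjoint S := hS
  have hdiag : ∀ r : ℝ, (algebraMap ℝ (Matrix (Fin n) (Fin n) ℝ) r).IsHermitian := fun r => by
    rw [Matrix.algebraMap_eq_diagonal]; exact isHermitian_diagonal _
  have hmv : ∀ (r : ℝ) (v : Fin n → ℝ),
      v ⬝ᵥ (algebraMap ℝ (Matrix (Fin n) (Fin n) ℝ) r) *ᵥ v = r * (v ⬝ᵥ v) := fun r v => by
    rw [Algebra.algebraMap_eq_smul_one, smul_mulVec, one_mulVec, dotProduct_smul, smul_eq_mul]
  simp only [forall_and]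
  rw [← algebraMap_le_iff_le_spectrum hS', ← le_algebraMap_iff_spectrum_le hS', Matrix.le_iff,
    Matrix.le_iff, posSemidef_iff_dotProduct_mulVec, posSemidef_iff_dotProduct_mulVec]
  rw [and_iff_right (hS.sub (hdiag a)), and_iff_right ((hdiag b).sub hS)]
  simp [sub_mulVec, hmv]

theorem spectrum_pos_of_posDef {S : Matrix (Fin n) (Fin n) ℝ} (hS : S.PosDef) {x : ℝ}
    (hx : x ∈ spectrum ℝ S) : 0 < x := by
  rw [hS.1.spectrum_real_eq_range_eigenvalues] at hx
  obtain ⟨i, rfl⟩ := hx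
  exact hS.eigenvalues_pos i

theorem isHermitian_cfc (f : ℝ → ℝ) (S : Matrix (Fin n) (Fin n) ℝ) : (cfc f S).IsHermitian :=
  cfc_predicate f S

theorem continuousOn_spectrum (f : ℝ → ℝ) (S : Matrix (Fin n) (Fin n) ℝ) :
    ContinuousOn f (spectrum ℝ S) := (Matrix.finite_spectrum S).continuousOn f

theorem spectralFn_norm_matLog_le_iff {S : Matrix (Fin n) (Fin n) ℝ} (hS : S.PosDef) {α : ℝ}
    (hα : 0 ≤ α) :
    spectralFn (fun x => ‖x‖) (matLog S) ≤ α ↔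
      ∀ v, Real.exp (-α) * (v ⬝ᵥ v) ≤ v ⬝ᵥ S *ᵥ v ∧ v ⬝ᵥ S *ᵥ v ≤ Real.exp α * (v ⬝ᵥ v) := by
  have hS' : IsSelfAdjoint S := hS.1
  rw [← spectrum_bounds_iff hS.1, matLog, spectralFn_norm_le_iff (isHermitian_cfc _ _) hα,
    cfc_map_spectrum Real.log S hS' (continuousOn_spectrum _ _), forall_mem_image]
  refine forall₂_congr fun x hx => ?_
  have hx := spectrum_pos_of_posDef hS hx
  rw [abs_le, Real.le_log_iff_exp_le hx, Real.log_le_iff_le_exp hx]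

theorem cfc_sqrt_mul_self {P : Matrix (Fin n) (Fin n) ℝ} (hP : P.PosDef) :
    cfc Real.sqrt P * cfc Real.sqrt P = P := by
  rw [← cfc_mul _ _ _ (continuousOn_spectrum _ _) (continuousOn_spectrum _ _)]
  conv_rhs => rw [← cfc_id ℝ P hP.1]
  exact cfc_congr fun x hx => Real.mul_self_sqrt (spectrum_pos_of_posDef hP hx).le

theorem isUnit_cfc_sqrt {P : Matrix (Fin n) (Fin n) ℝ} (hP : P.PosDef) :
    IsUnit (cfc Real.sqrt P) :=
  isUnit_of_mul_isUnit_left (cfc_sqrt_mul_self hP ▸ hP.isUnit)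

theorem isHermitian_invSqrt (P : Matrix (Fin n) (Fin n) ℝ) : (invSqrt P).IsHermitian :=
  (isHermitian_cfc _ _).inv

theorem posDef_invSqrt_mul_mul_invSqrt {P Q : Matrix (Fin n) (Fin n) ℝ} (hP : P.PosDef)
    (hQ : Q.PosDef) : (invSqrt P * Q * invSqrt P).PosDef := by
  have hu : IsUnit (invSqrt P) := (isUnit_nonsing_inv_iff).2 (isUnit_cfc_sqrt hP)
  have := (IsUnit.posDef_star_right_conjugate_iff hu).2 hQ
  rwa [star_eq_conjTranspose, (isHermitian_invSqrt P).eq] at this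

/-- The Thompson metric in terms of the order of quadratic forms. -/
theorem finslerDist_norm_le_iff {P Q : Matrix (Fin n) (Fin n) ℝ} (hP : P.PosDef)
    (hQ : Q.PosDef) {α : ℝ} (hα : 0 ≤ α) :
    finslerDist (fun x => ‖x‖) P Q ≤ α ↔
      ∀ v, Real.exp (-α) * (v ⬝ᵥ P *ᵥ v) ≤ v ⬝ᵥ Q *ᵥ v ∧
        v ⬝ᵥ Q *ᵥ v ≤ Real.exp α * (v ⬝ᵥ P *ᵥ v) := by
  rw [finslerDist, spectralFn_norm_matLog_le_iff (posDef_invSqrt_mul_mul_invSqrt hP hQ) hα]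
  set W := cfc Real.sqrt P with hW
  have hWP : W * W = P := cfc_sqrt_mul_self hP
  have hWu : IsUnit W.det := (isUnit_iff_isUnit_det _).1 (isUnit_cfc_sqrt hP)
  have hWh : Wᵀ = W := by simpa using (isHermitian_cfc Real.sqrt P).eq
  -- The substitution of `W *ᵥ v` for `v` turns bounds relative to the identity into bounds relative
  -- to `P`.
  have hs : Function.Surjective (fun v => W *ᵥ v) := fun v =>
    ⟨W⁻¹ *ᵥ v, by simp [mulVec_mulVec, mul_nonsing_inv W hWu]⟩
  have h1 : ∀ v, (W *ᵥ v) ⬝ᵥ (W *ᵥ v) = v ⬝ᵥ P *ᵥ v := fun v => by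
    rw [dotProduct_mulVec, ← mulVec_transpose, mulVec_mulVec, hWh, hWP, dotProduct_comm]
  have h2 : ∀ v, (W *ᵥ v) ⬝ᵥ (W⁻¹ * Q * W⁻¹) *ᵥ (W *ᵥ v) = v ⬝ᵥ Q *ᵥ v := fun v => by
    have : (W *ᵥ v) = v ᵥ* W := by rw [← mulVec_transpose, hWh]
    rw [mulVec_mulVec, Matrix.mul_assoc, nonsing_inv_mul W hWu, Matrix.mul_one, this,
      ← dotProduct_mulVec, mulVec_mulVec, ← Matrix.mul_assoc, mul_nonsing_inv W hWu,
      Matrix.one_mul]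
  rw [hs.forall]
  simp only [invSqrt, ← hW, h1, h2]

theorem finslerDist_const_mul (a : ℝ) (ν : (Fin n → ℝ) → ℝ) (P Q : Matrix (Fin n) (Fin n) ℝ) :
    finslerDist (fun x => a * ν x) P Q = a * finslerDist ν P Q := by
  simp only [finslerDist, spectralFn]
  split_ifs <;> simp

theorem finslerDist_norm_nonneg (P Q : Matrix (Fin n) (Fin n) ℝ) :
    0 ≤ finslerDist (fun x => ‖x‖) P Q := by
  simp only [finslerDist, spectralFn]
  split_ifs <;> simp

/-! ### Non-expansiveness forces the sup-norm -/

/-- Data for which the equation reads `Ṗ = P j j • E i i`. -/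
def transferCoeffs (k : ℕ) (i j : Fin n) : Coeffs n k where
  A := 0
  B := 0
  C := single j i 1
  D := 0
  L := 0
  Q := 0
  R := 1

theorem admissible_transferCoeffs (i j : Fin n) : (transferCoeffs k i j).Admissible := by
  refine ⟨PosSemidef.of_dotProduct_mulVec_nonneg ?_ fun x => ?_, fun u hu _ => ?_⟩
  · exact isHermitian_zero.fromBlocks (by simp [transferCoeffs]) isHermitian_one
  · rw [fromBlocks_mulVec]
    simp only [transferCoeffs, dotProduct, Fintype.sum_sum_type, zero_mulVec, transpose_zero]
    refine add_nonneg (Finset.sum_nonneg fun i _ => ?_) (Finset.sum_nonneg fun i _ => ?_)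
    · simp
    · simpa using mul_self_nonneg _
  · simpa [transferCoeffs] using hu

theorem phi_transferCoeffs_diagonal (i j : Fin n) (p : Fin n → ℝ) :
    (transferCoeffs k i j).phi (diagonal p) = single i i (p j) := by
  simp [Coeffs.phi, transferCoeffs]

/-- As `i ≠ j`, entry `j` stays constant, so entry `i` grows linearly. -/
theorem flowsTo_transferCoeffs {i j : Fin n} (hij : i ≠ j) {p : Fin n → ℝ} (hp : ∀ l, 0 < p l)
    (t : ℝ) :
    FlowsTo (fun _ => transferCoeffs k i j) 0 t (diagonal p)
      (diagonal (p + Pi.single i (t * p j))) := by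
  refine ⟨fun r => diagonal (p + Pi.single i (r * p j)), fun r hr => ⟨?_, fun a b => ?_⟩,
    by simp, rfl⟩
  · refine PosDef.diagonal fun l => ?_
    by_cases hl : l = i
    · subst hl
      simpa using add_pos_of_pos_of_nonneg (hp l) (mul_nonneg hr.1 (hp j).le)
    · simpa [hl] using hp l
  · rw [phi_transferCoeffs_diagonal]
    refine HasDerivAt.hasDerivWithinAt ?_
    by_cases hab : a = b
    · subst hab
      by_cases hl : a = i
      · subst hl
        simpa [hij.symm] using ((hasDerivAt_id r).mul_const (p j)).const_add (p a)
      · simpa [hl, Ne.symm hl] using hasDerivAt_const r (p a)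
    · have : ¬ (i = a ∧ i = b) := fun h => hab (h.1.symm.trans h.2)
      simpa [hab, single_apply, this] using hasDerivAt_const r (0 : ℝ)

/-- Compare the solutions from the identity and from `exp` of the indicator of `s`. The logarithmic
ratio in entry `i` starts at `0` and tends to `1` as time grows, while the other ratios do not move.
-/
theorem IsSymmetricGauge.indicator_insert_le {ν : (Fin n → ℝ) → ℝ} (h : IsSymmetricGauge ν)
    (hne : ∀ c : Coeffs n k, c.Admissible →
      NonExpansive (finslerDist ν) (fun _ => c) (Ici 0))
    {s : Finset (Fin n)} {i j : Fin n} (hj : j ∈ s) (hi : i ∉ s) :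
    ν (fun l => if l ∈ insert i s then 1 else 0) ≤ ν (fun l => if l ∈ s then 1 else 0) := by
  set e : Fin n → ℝ := fun l => if l ∈ s then 1 else 0 with he
  set e' : Fin n → ℝ := fun l => if l ∈ insert i s then 1 else 0 with he'
  have hij : i ≠ j := fun hij => hi (hij ▸ hj)
  have key : ∀ w ∈ Ioo (0 : ℝ) 1, w * ν e' ≤ ν e := by
    rintro w ⟨hw0, hw1⟩
    have hE : 0 < Real.exp 1 - Real.exp w := sub_pos.2 (Real.exp_lt_exp.2 hw1)
    have hw : 0 < Real.exp w - 1 := by linarith [Real.add_one_lt_exp hw0.ne']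
    -- The time at which the logarithmic ratio in entry `i` equals `w`; see `hte`.
    set t := (Real.exp w - 1) / (Real.exp 1 - Real.exp w) with ht
    have ht0 : 0 ≤ t := (div_pos hw hE).le
    have hte : (1 + t * Real.exp 1) / (1 + t) = Real.exp w := by
      have h1 : t * (Real.exp 1 - Real.exp w) = Real.exp w - 1 := div_mul_cancel₀ _ hE.ne'
      rw [div_eq_iff (by positivity)]
      linarith
    have hq : ∀ l, 0 < Real.exp (e l) := fun l => Real.exp_pos _
    have hp1 : ∀ l, 0 < ((fun _ => 1) + Pi.single i (t * 1) : Fin n → ℝ) l := fun l => by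
      by_cases hl : l = i
      · subst hl; simp; positivity
      · simp [hl]
    have := hne _ (admissible_transferCoeffs i j) 0 self_mem_Ici t ht0 ht0 _ _ _ _
      (flowsTo_transferCoeffs hij (p := fun _ => 1) (fun _ => one_pos) t)
      (flowsTo_transferCoeffs hij hq t)
    rw [h.finslerDist_diagonal hp1, h.finslerDist_diagonal fun _ => one_pos] at this
    rw [← h.map_smul hw0.le]
    refine (h.mono fun l => ?_).trans (this.trans_eq ?_)
    · by_cases hl : l = i
      · subst hl
        have hel : e l = 0 := by simp [he, hi]
        have hej : e j = 1 := by simp [he, hj]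
        simp [he', hel, hej, hte, abs_of_pos hw0]
      · by_cases hls : l ∈ s
        · simp [he', he, hl, hls, abs_of_pos hw0, hw1.le]
        · simp [he', he, hl, hls]
    · simp
  by_contra! hlt
  have h0 : 0 < ν e' := (h.nonneg e).trans_lt hlt
  obtain ⟨w, hw1, hw2⟩ := exists_between ((div_lt_one h0).2 hlt)
  have hw0 : 0 < w := (div_nonneg (h.nonneg e) h0.le).trans_lt hw1
  exact absurd (key w ⟨hw0, hw2⟩) (not_le.2 ((div_lt_iff₀ h0).1 hw1))

theorem IsSymmetricGauge.eq_smul_norm_of_nonExpansive {ν : (Fin n → ℝ) → ℝ}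
    (h : IsSymmetricGauge ν)
    (hne : ∀ c : Coeffs n k, c.Admissible →
      NonExpansive (finslerDist ν) (fun _ => c) (Ici 0)) :
    ∃ a : ℝ, 0 ≤ a ∧ ∀ x : Fin n → ℝ, ν x = a * ‖x‖ := by
  refine h.eq_smul_norm fun j => ?_
  -- Keeping `j` in the set provides a source entry for every insertion.
  have key : ∀ s : Finset (Fin n), ν (fun l => if l ∈ insert j s then 1 else 0) ≤
      ν (Pi.single j 1) := fun s => by
    induction s using Finset.induction_on with
    | empty =>
      refine le_of_eq (congrArg ν (funext fun l => ?_))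
      simp [Pi.single_apply]
    | insert i s _ ih =>
      rw [Finset.insert_comm]
      by_cases hi : i ∈ insert j s
      · rwa [Finset.insert_eq_of_mem hi]
      · exact (h.indicator_insert_le hne (Finset.mem_insert_self j s) hi).trans ih
  simpa using key Finset.univ

/-! ### The right-hand side as a minimum over controls -/

theorem dotProduct_mulVec_transpose {m l : Type*} [Fintype m] [Fintype l] (M : Matrix m l ℝ)
    (x : l → ℝ) (y : m → ℝ) : x ⬝ᵥ Mᵀ *ᵥ y = (M *ᵥ x) ⬝ᵥ y := by
  rw [mulVec_transpose, dotProduct_comm, ← dotProduct_mulVec, dotProduct_comm]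

theorem dotProduct_mulVec_comm {m : Type*} [Fintype m] {M : Matrix m m ℝ} (hM : Mᵀ = M)
    (x y : m → ℝ) : x ⬝ᵥ M *ᵥ y = y ⬝ᵥ M *ᵥ x := by
  conv_lhs => rw [← hM, dotProduct_mulVec_transpose, dotProduct_comm]

namespace Coeffs

variable (c : Coeffs n k)

/-- The quadratic running cost of the state `v` and the control `u`. -/
def cost (v : Fin n → ℝ) (u : Fin k → ℝ) : ℝ :=
  v ⬝ᵥ c.Q *ᵥ v + 2 * (u ⬝ᵥ c.L *ᵥ v) + u ⬝ᵥ c.R *ᵥ u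

/-- The Hamiltonian whose minimum over the controls `u` is the quadratic form of `c.phi P`. -/
def hamiltonian (P : Matrix (Fin n) (Fin n) ℝ) (v : Fin n → ℝ) (u : Fin k → ℝ) : ℝ :=
  2 * ((c.A *ᵥ v + c.B *ᵥ u) ⬝ᵥ P *ᵥ v) +
    (c.C *ᵥ v + c.D *ᵥ u) ⬝ᵥ P *ᵥ (c.C *ᵥ v + c.D *ᵥ u) + c.cost v u

variable {c}

theorem Admissible.cost_nonneg (hc : c.Admissible) (v : Fin n → ℝ) (u : Fin k → ℝ) :
    0 ≤ c.cost v u := by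
  have h := hc.1.dotProduct_mulVec_nonneg (Sum.elim v u)
  rw [fromBlocks_mulVec] at h
  have e : v ⬝ᵥ c.Lᵀ *ᵥ u = u ⬝ᵥ c.L *ᵥ v := by
    rw [dotProduct_mulVec_transpose, dotProduct_comm]
  have : star (Sum.elim v u) = Sum.elim v u := rfl
  simp only [this, Sum.elim_comp_inl, Sum.elim_comp_inr, sumElim_dotProduct_sumElim,
    dotProduct_add, e] at h
  rw [cost]
  linarith

/-- Both summands are positive semidefinite, and their forms vanish together only on `ker R ∩ ker
D`. -/
theorem Admissible.posDef (hc : c.Admissible) {P : Matrix (Fin n) (Fin n) ℝ} (hP : P.PosDef) :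
    (c.R + c.Dᵀ * P * c.D).PosDef := by
  have hR : c.R.PosSemidef := hc.1.submatrix Sum.inr
  have hD : (c.Dᵀ * P * c.D).PosSemidef := by
    simpa using hP.posSemidef.conjTranspose_mul_mul_same c.D
  refine PosDef.of_dotProduct_mulVec_pos (hR.1.add hD.1) fun u hu => ?_
  have h1 := hR.dotProduct_mulVec_nonneg u
  have h2 : star u ⬝ᵥ (c.Dᵀ * P * c.D) *ᵥ u = star (c.D *ᵥ u) ⬝ᵥ P *ᵥ (c.D *ᵥ u) := by
    rw [← mulVec_mulVec, ← mulVec_mulVec]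
    exact dotProduct_mulVec_transpose _ _ _
  rw [add_mulVec, dotProduct_add, h2]
  by_cases hDu : c.D *ᵥ u = 0
  · refine add_pos_of_pos_of_nonneg (h1.lt_of_ne' fun h => hu (hc.2 u ?_ hDu)) ?_
    · exact (hR.dotProduct_mulVec_zero_iff u).1 h
    · simp [hDu]
  · exact add_pos_of_nonneg_of_pos h1 (hP.dotProduct_mulVec_pos hDu)

/-- Completion of the square in `u`. -/
theorem Admissible.hamiltonian_eq (hc : c.Admissible) {P : Matrix (Fin n) (Fin n) ℝ}
    (hP : P.PosDef) (v : Fin n → ℝ) (u : Fin k → ℝ) :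
    let S := c.R + c.Dᵀ * P * c.D
    let N := c.Bᵀ * P + c.Dᵀ * P * c.C + c.L
    let z := u + S⁻¹ *ᵥ N *ᵥ v
    c.hamiltonian P v u = v ⬝ᵥ c.phi P *ᵥ v + z ⬝ᵥ S *ᵥ z := by
  intro S N z
  have hS : S.PosDef := hc.posDef hP
  have hSu : IsUnit S.det := (isUnit_iff_isUnit_det _).1 hS.isUnit
  have hSt : Sᵀ = S := by simpa using hS.1.eq
  have hPt : Pᵀ = P := by simpa using hP.1.eq
  have hz : z ⬝ᵥ S *ᵥ z = u ⬝ᵥ S *ᵥ u + 2 * (u ⬝ᵥ N *ᵥ v) + (N *ᵥ v) ⬝ᵥ S⁻¹ *ᵥ N *ᵥ v := by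
    have h1 : S *ᵥ z = S *ᵥ u + N *ᵥ v := by
      rw [mulVec_add, mulVec_mulVec, mul_nonsing_inv S hSu, one_mulVec]
    have h2 : (S⁻¹ *ᵥ N *ᵥ v) ⬝ᵥ S *ᵥ u = u ⬝ᵥ N *ᵥ v := by
      rw [dotProduct_mulVec_comm hSt, mulVec_mulVec, mul_nonsing_inv S hSu, one_mulVec]
    rw [h1]
    simp only [z, add_dotProduct, dotProduct_add, h2]
    rw [dotProduct_comm (S⁻¹ *ᵥ N *ᵥ v) (N *ᵥ v)]
    ring
  have hphi : c.phi P = c.Aᵀ * P + P * c.A + c.Cᵀ * P * c.C + c.Q - Nᵀ * S⁻¹ * N := rfl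
  rw [hz, hphi]
  have hSe : u ⬝ᵥ S *ᵥ u = u ⬝ᵥ c.R *ᵥ u + (c.D *ᵥ u) ⬝ᵥ P *ᵥ c.D *ᵥ u := by
    simp only [S, add_mulVec, dotProduct_add, ← mulVec_mulVec, dotProduct_mulVec_transpose]
  have hNe : u ⬝ᵥ N *ᵥ v = (c.B *ᵥ u) ⬝ᵥ P *ᵥ v + (c.D *ᵥ u) ⬝ᵥ P *ᵥ c.C *ᵥ v +
      u ⬝ᵥ c.L *ᵥ v := by
    simp only [N, add_mulVec, dotProduct_add, ← mulVec_mulVec, dotProduct_mulVec_transpose]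
  rw [hSe, hNe]
  simp only [hamiltonian, cost, sub_mulVec, add_mulVec, dotProduct_sub, dotProduct_add,
    add_dotProduct, mulVec_add, ← mulVec_mulVec, dotProduct_mulVec_transpose]
  rw [dotProduct_mulVec_comm hPt v, dotProduct_mulVec_comm hPt (c.C *ᵥ v) (c.D *ᵥ u)]
  ring

theorem Admissible.phi_le_hamiltonian (hc : c.Admissible) {P : Matrix (Fin n) (Fin n) ℝ}
    (hP : P.PosDef) (v : Fin n → ℝ) (u : Fin k → ℝ) :
    v ⬝ᵥ c.phi P *ᵥ v ≤ c.hamiltonian P v u := by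
  rw [hc.hamiltonian_eq hP]
  exact le_add_of_nonneg_right ((hc.posDef hP).posSemidef.dotProduct_mulVec_nonneg _)

theorem Admissible.exists_hamiltonian_eq (hc : c.Admissible) {P : Matrix (Fin n) (Fin n) ℝ}
    (hP : P.PosDef) (v : Fin n → ℝ) :
    ∃ u, c.hamiltonian P v u = v ⬝ᵥ c.phi P *ᵥ v := by
  refine ⟨-((c.R + c.Dᵀ * P * c.D)⁻¹ *ᵥ (c.Bᵀ * P + c.Dᵀ * P * c.C + c.L) *ᵥ v), ?_⟩
  rw [hc.hamiltonian_eq hP]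
  simp

/-- At a point where the quadratic form of `Y` touches `μ` times that of `X` from below, with
`1 ≤ μ`, the vector field `φ` does not push `Y` above `μ X`. -/
theorem Admissible.phi_le_smul_phi (hc : c.Admissible) {X Y : Matrix (Fin n) (Fin n) ℝ}
    (hX : X.PosDef) (hY : Y.PosDef) {μ : ℝ} (hμ : 1 ≤ μ)
    (hle : ∀ w, w ⬝ᵥ Y *ᵥ w ≤ μ * (w ⬝ᵥ X *ᵥ w)) {v : Fin n → ℝ}
    (hv : v ⬝ᵥ Y *ᵥ v = μ * (v ⬝ᵥ X *ᵥ v)) :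
    v ⬝ᵥ c.phi Y *ᵥ v ≤ μ * (v ⬝ᵥ c.phi X *ᵥ v) := by
  have hsub : ∀ w w', w' ⬝ᵥ (μ • X - Y) *ᵥ w = μ * (w' ⬝ᵥ X *ᵥ w) - w' ⬝ᵥ Y *ᵥ w :=
    fun w w' => by rw [sub_mulVec, smul_mulVec, dotProduct_sub, dotProduct_smul, smul_eq_mul]
  have hZ : (μ • X - Y).PosSemidef := by
    refine PosSemidef.of_dotProduct_mulVec_nonneg ?_ fun w => ?_
    · exact (hX.posSemidef.smul (zero_le_one.trans hμ)).1.sub hY.1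
    · rw [star_trivial, hsub]
      exact sub_nonneg.2 (hle w)
  -- A null vector of a positive semidefinite form lies in its kernel, so the terms linear in `P *ᵥ
  -- v` match exactly.
  have hYv : Y *ᵥ v = μ • X *ᵥ v := by
    have h0 := (hZ.dotProduct_mulVec_zero_iff v).1 (by rw [star_trivial, hsub, hv, sub_self])
    rw [sub_mulVec, smul_mulVec, sub_eq_zero] at h0
    exact h0.symm
  -- The control optimal for `X` is merely a competitor for `Y`.
  obtain ⟨u, hu⟩ := hc.exists_hamiltonian_eq hX v
  rw [← hu]
  refine (hc.phi_le_hamiltonian hY v u).trans ?_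
  have h1 := hle (c.C *ᵥ v + c.D *ᵥ u)
  have h2 := mul_nonneg (sub_nonneg.2 hμ) (hc.cost_nonneg v u)
  rw [hamiltonian, hamiltonian, hYv, dotProduct_smul, smul_eq_mul]
  linarith

end Coeffs

/-! ### Propagation of order bounds along trajectories -/

theorem IsTrajectory.hasDerivWithinAt_quadratic {c : ℝ → Coeffs n k} {s t : ℝ}
    {X : ℝ → Matrix (Fin n) (Fin n) ℝ} (hX : IsTrajectory c s t X) {τ : ℝ} (hτ : τ ∈ Icc s t)
    (v : Fin n → ℝ) :
    HasDerivWithinAt (fun r => v ⬝ᵥ X r *ᵥ v) (v ⬝ᵥ (c τ).phi (X τ) *ᵥ v) (Icc s t) τ := by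
  simp only [dotProduct, mulVec]
  exact HasDerivWithinAt.fun_sum fun i _ => (HasDerivWithinAt.fun_sum fun j _ =>
    ((hX τ hτ).2 i j).mul_const (v j)).const_mul (v i)

theorem IsTrajectory.continuousOn_quadratic {c : ℝ → Coeffs n k} {s t : ℝ}
    {X : ℝ → Matrix (Fin n) (Fin n) ℝ} (hX : IsTrajectory c s t X) :
    ContinuousOn (fun p : ℝ × (Fin n → ℝ) => p.2 ⬝ᵥ X p.1 *ᵥ p.2) (Icc s t ×ˢ univ) := by
  have hc : ∀ i j, ContinuousOn (fun p : ℝ × (Fin n → ℝ) => X p.1 i j) (Icc s t ×ˢ univ) :=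
    fun i j => by
      have h1 : ContinuousOn (fun r => X r i j) (Icc s t) := fun τ hτ =>
        ((hX τ hτ).2 i j).continuousWithinAt
      exact h1.comp continuousOn_fst fun p hp => hp.1
  simp only [dotProduct, mulVec]
  refine continuousOn_finsetSum _ fun i _ => ContinuousOn.mul (by fun_prop)
    (continuousOn_finsetSum _ fun j _ => (hc i j).mul (by fun_prop))

/-- A function that is nonnegative on `[s, τ]` and vanishes at `τ` has nonpositive derivative. -/
theorem nonpos_of_hasDerivWithinAt_of_nonneg {f : ℝ → ℝ} {f' s t τ : ℝ} (hτ : τ ∈ Ioc s t)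
    (hf : HasDerivWithinAt f f' (Icc s t) τ) (h0 : f τ = 0) (hpos : ∀ r ∈ Icc s τ, 0 ≤ f r) :
    f' ≤ 0 := by
  have h1 : HasDerivWithinAt f f' (Iio τ) τ :=
    hf.mono_of_mem_nhdsWithin (Icc_mem_nhdsLT_of_mem hτ)
  rw [hasDerivWithinAt_iff_tendsto_slope' self_notMem_Iio] at h1
  refine le_of_tendsto h1 ?_
  filter_upwards [Ioo_mem_nhdsLT hτ.1] with r hr
  rw [slope_def_field, h0, sub_zero]
  exact div_nonpos_of_nonneg_of_nonpos (hpos r ⟨hr.1.le, hr.2.le⟩) (sub_nonpos.2 hr.2.le)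

/-- Upper bounds `Y ≤ μ X` with `1 ≤ μ` between trajectories propagate in time. -/
theorem IsTrajectory.le_smul {c : ℝ → Coeffs n k} {s t : ℝ} (hst : s ≤ t)
    (hc : ∀ τ ∈ Icc s t, (c τ).Admissible)
    {X Y : ℝ → Matrix (Fin n) (Fin n) ℝ} (hX : IsTrajectory c s t X)
    (hY : IsTrajectory c s t Y) {μ : ℝ} (hμ : 1 ≤ μ)
    (h0 : ∀ v, v ⬝ᵥ Y s *ᵥ v ≤ μ * (v ⬝ᵥ X s *ᵥ v)) (v : Fin n → ℝ) :
    v ⬝ᵥ Y t *ᵥ v ≤ μ * (v ⬝ᵥ X t *ᵥ v) := by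
  have hXpos : ∀ τ ∈ Icc s t, ∀ w : Fin n → ℝ, w ≠ 0 → 0 < w ⬝ᵥ X τ *ᵥ w := fun τ hτ w hw =>
    (hX τ hτ).1.dotProduct_mulVec_pos hw
  rcases eq_or_ne v 0 with rfl | hv
  · simp
  have : Nonempty (Fin n) := by
    by_contra h
    rw [not_nonempty_iff] at h
    exact hv (Subsingleton.elim _ _)
  set K : Set (ℝ × (Fin n → ℝ)) := Icc s t ×ˢ Metric.sphere 0 1 with hK
  have hsphere : ∀ w ∈ Metric.sphere (0 : Fin n → ℝ) 1, w ≠ 0 := fun w hw =>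
    ne_zero_of_mem_unit_sphere ⟨w, hw⟩
  have hKc : IsCompact K := isCompact_Icc.prod (isCompact_sphere 0 1)
  have hKu : K ⊆ Icc s t ×ˢ univ := prod_mono_right (subset_univ _)
  have hunit : ∀ u : Fin n → ℝ, u ≠ 0 → ‖u‖⁻¹ • u ∈ Metric.sphere (0 : Fin n → ℝ) 1 :=
    fun u hu => by simp [norm_smul, norm_ne_zero_iff.2 hu]
  have hhom : ∀ u : Fin n → ℝ, u ≠ 0 → ∀ Z W : Matrix (Fin n) (Fin n) ℝ,
      ((‖u‖⁻¹ • u) ⬝ᵥ Z *ᵥ (‖u‖⁻¹ • u)) / ((‖u‖⁻¹ • u) ⬝ᵥ W *ᵥ (‖u‖⁻¹ • u)) =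
        (u ⬝ᵥ Z *ᵥ u) / (u ⬝ᵥ W *ᵥ u) := fun u hu Z W => by
    have hn : ‖u‖⁻¹ ≠ 0 := inv_ne_zero (norm_ne_zero_iff.2 hu)
    simp only [mulVec_smul, smul_dotProduct, dotProduct_smul, smul_eq_mul]
    rw [mul_div_mul_left _ _ hn, mul_div_mul_left _ _ hn]
  -- The damping factor supplies the strict inequality for a first-order argument at a maximum; it
  -- is removed at the end by `ε → 0`.
  have hratio : ∀ ε > 0, ∀ p ∈ K, Real.exp (-(ε * (p.1 - s))) *
      ((p.2 ⬝ᵥ Y p.1 *ᵥ p.2) / (p.2 ⬝ᵥ X p.1 *ᵥ p.2)) ≤ μ := fun ε hε => by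
    by_contra! hcon
    set f : ℝ × (Fin n → ℝ) → ℝ := fun p => Real.exp (-(ε * (p.1 - s))) *
      ((p.2 ⬝ᵥ Y p.1 *ᵥ p.2) / (p.2 ⬝ᵥ X p.1 *ᵥ p.2)) with hf
    have hfc : ContinuousOn f K :=
      ContinuousOn.mul (by fun_prop) ((hY.continuousOn_quadratic.mono hKu).div
        (hX.continuousOn_quadratic.mono hKu) fun p hp =>
          (hXpos p.1 hp.1 p.2 (hsphere _ hp.2)).ne')
    obtain ⟨p, hpK, hp⟩ := hcon
    obtain ⟨⟨τ, w⟩, hqK, hmax⟩ := hKc.exists_isMaxOn ⟨p, hpK⟩ hfc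
    set ρ := f (τ, w) with hρ
    have hρμ : μ < ρ := hp.trans_le (hmax hpK)
    have hτ : τ ∈ Icc s t := hqK.1
    have hw : w ≠ 0 := hsphere _ hqK.2
    -- the maximum bounds `Y` on the whole time interval
    have hbound : ∀ r ∈ Icc s t, ∀ u : Fin n → ℝ,
        u ⬝ᵥ Y r *ᵥ u ≤ ρ * Real.exp (ε * (r - s)) * (u ⬝ᵥ X r *ᵥ u) := fun r hr u => by
      rcases eq_or_ne u 0 with rfl | hu
      · simp
      have hle : f (r, ‖u‖⁻¹ • u) ≤ ρ := hmax (show (r, ‖u‖⁻¹ • u) ∈ K from ⟨hr, hunit u hu⟩)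
      have hfu : f (r, ‖u‖⁻¹ • u) =
          (u ⬝ᵥ Y r *ᵥ u) / (u ⬝ᵥ X r *ᵥ u) / Real.exp (ε * (r - s)) := by
        simp only [hf, hhom u hu, Real.exp_neg]
        rw [inv_mul_eq_div]
      rw [hfu, div_le_iff₀ (Real.exp_pos _), div_le_iff₀ (hXpos r hr u hu)] at hle
      exact hle
    have heq : w ⬝ᵥ Y τ *ᵥ w = ρ * Real.exp (ε * (τ - s)) * (w ⬝ᵥ X τ *ᵥ w) := by
      have := (hXpos τ hτ w hw).ne'
      simp only [hρ, hf, Real.exp_neg]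
      field_simp
    -- A maximum above `μ` cannot sit at the initial time, so a left derivative is available at `τ`.
    have hsτ : s < τ := by
      refine hτ.1.lt_of_ne fun h => ?_
      subst h
      have h1 := h0 w
      rw [heq, sub_self, mul_zero, Real.exp_zero, mul_one] at h1
      exact absurd (le_of_mul_le_mul_right h1 (hXpos s hτ w hw)) (not_le.2 hρμ)
    have hexp : 1 ≤ Real.exp (ε * (τ - s)) :=
      Real.one_le_exp (mul_nonneg hε.le (sub_nonneg.2 hτ.1))
    have hρ1 : 1 ≤ ρ := hμ.trans hρμ.le
    set m := ρ * Real.exp (ε * (τ - s)) with hm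
    have hm1 : 1 ≤ m := one_le_mul_of_one_le_of_one_le hρ1 hexp
    have hexp' : HasDerivWithinAt (fun r => ρ * Real.exp (ε * (r - s))) (ε * m) (Icc s t) τ := by
      have h1 : HasDerivAt (fun r => ε * (r - s)) ε τ := by
        simpa using ((hasDerivAt_id τ).sub_const s).const_mul ε
      have h2 := (h1.exp.const_mul ρ).hasDerivWithinAt (s := Icc s t)
      exact h2.congr_deriv (by rw [hm]; ring)
    -- The gap between the damped bound and `Y` in direction `w` is nonnegative and vanishes at `τ`,
    -- so its derivative is at most `0`; but `phi_le_smul_phi` makes it at least `ε * m * (w ⬝ᵥ X τ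
    -- *ᵥ w) > 0`.
    have hder := (hexp'.mul (hX.hasDerivWithinAt_quadratic hτ w)).sub
      (hY.hasDerivWithinAt_quadratic hτ w)
    have hnonpos := nonpos_of_hasDerivWithinAt_of_nonneg ⟨hsτ, hτ.2⟩ hder
      (by simp [heq, hm]) fun r hr =>
        sub_nonneg.2 (hbound r ⟨hr.1, hr.2.trans hτ.2⟩ w)
    have hphi := (hc τ hτ).phi_le_smul_phi (hX τ hτ).1 (hY τ hτ).1 hm1 (hbound τ hτ) heq
    have hstrict : 0 < ε * m * (w ⬝ᵥ X τ *ᵥ w) :=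
      mul_pos (mul_pos hε (zero_lt_one.trans_le hm1)) (hXpos τ hτ w hw)
    linarith
  have htmem : t ∈ Icc s t := right_mem_Icc.2 hst
  rw [← div_le_iff₀ (hXpos t htmem v hv)]
  have hlim : Filter.Tendsto (fun ε : ℝ => Real.exp (-(ε * (t - s))) *
      ((v ⬝ᵥ Y t *ᵥ v) / (v ⬝ᵥ X t *ᵥ v))) (nhdsWithin 0 (Ioi 0))
      (nhds ((v ⬝ᵥ Y t *ᵥ v) / (v ⬝ᵥ X t *ᵥ v))) := by
    refine Filter.Tendsto.mono_left ?_ nhdsWithin_le_nhds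
    refine Continuous.tendsto' (by fun_prop) _ _ ?_
    simp
  refine le_of_tendsto hlim ?_
  filter_upwards [self_mem_nhdsWithin] with ε hε
  simpa only [hhom v hv] using hratio ε hε (t, ‖v‖⁻¹ • v) ⟨htmem, hunit v hv⟩

theorem FlowsTo.finslerDist_norm_le {c : ℝ → Coeffs n k} {s t : ℝ} (hst : s ≤ t)
    (hc : ∀ τ ∈ Icc s t, (c τ).Admissible) {G₁ G₂ P₁ P₂ : Matrix (Fin n) (Fin n) ℝ}
    (h₁ : FlowsTo c s t G₁ P₁) (h₂ : FlowsTo c s t G₂ P₂) :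
    finslerDist (fun x => ‖x‖) P₁ P₂ ≤ finslerDist (fun x => ‖x‖) G₁ G₂ := by
  obtain ⟨X, hX, rfl, rfl⟩ := h₁
  obtain ⟨Y, hY, rfl, rfl⟩ := h₂
  have hs : s ∈ Icc s t := left_mem_Icc.2 hst
  have ht : t ∈ Icc s t := right_mem_Icc.2 hst
  have hα := finslerDist_norm_nonneg (X s) (Y s)
  have h0 := (finslerDist_norm_le_iff (hX s hs).1 (hY s hs).1 hα).1 le_rfl
  have hexp := Real.one_le_exp hα
  -- The lower bound is an upper bound with the trajectories exchanged.
  have hinv : ∀ x y : ℝ, Real.exp (-finslerDist (fun x => ‖x‖) (X s) (Y s)) * x ≤ y ↔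
      x ≤ Real.exp (finslerDist (fun x => ‖x‖) (X s) (Y s)) * y := fun x y => by
    rw [Real.exp_neg, inv_mul_le_iff₀ (Real.exp_pos _)]
  refine (finslerDist_norm_le_iff (hX t ht).1 (hY t ht).1 hα).2 fun v => ⟨?_, ?_⟩
  · rw [hinv]
    exact hY.le_smul hst hc hX hexp (fun w => (hinv _ _).1 (h0 w).1) v
  · exact hX.le_smul hst hc hY hexp (fun w => (h0 w).2) v

end GRDE

/-- The norm `‖x‖` on `Fin n → ℝ` is the sup-norm. -/
theorem mainTheorem3 (n k : ℕ) :
    (∀ ν : (Fin n → ℝ) → ℝ, GRDE.IsSymmetricGauge ν →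
      List.TFAE [
        -- time-dependent data on a bounded time interval
        ∀ T : ℝ, 0 < T → ∀ c : ℝ → GRDE.Coeffs n k,
          GRDE.ContinuousData c (Set.Icc 0 T) → (∀ t ∈ Set.Icc 0 T, (c t).Admissible) →
            GRDE.NonExpansive (GRDE.finslerDist ν) c (Set.Icc 0 T),
        -- constant data
        ∀ c : GRDE.Coeffs n k, c.Admissible →
          GRDE.NonExpansive (GRDE.finslerDist ν) (fun _ => c) (Set.Ici 0),
        ∃ a : ℝ, 0 ≤ a ∧ ∀ x : Fin n → ℝ, ν x = a * ‖x‖]) ∧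
    (2 ≤ n → ∃ c : GRDE.Coeffs n k, c.Admissible ∧
      ¬ GRDE.NonExpansive (GRDE.finslerDist GRDE.euclideanGauge) (fun _ => c) (Set.Ici 0)) := by
  refine ⟨fun ν hν => ?_, fun hn => ?_⟩
  · tfae_have 1 → 2 := fun h c hc s hs t ht hst =>
      -- The horizon `t + 1` stays positive even when `t = 0`.
      h (t + 1) (add_pos_of_nonneg_of_pos ht one_pos) (fun _ => c)
        ⟨continuousOn_const, continuousOn_const, continuousOn_const, continuousOn_const,
          continuousOn_const, continuousOn_const, continuousOn_const⟩
        (fun _ _ => hc) s ⟨hs, by linarith⟩ t ⟨ht, by linarith⟩ hst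
    tfae_have 2 → 3 := hν.eq_smul_norm_of_nonExpansive
    tfae_have 3 → 1 := by
      rintro ⟨a, ha, hνa⟩ T _ c _ hc s hs t ht hst G₁ G₂ P₁ P₂ h₁ h₂
      obtain rfl : ν = fun x => a * ‖x‖ := funext hνa
      rw [GRDE.finslerDist_const_mul, GRDE.finslerDist_const_mul]
      exact mul_le_mul_of_nonneg_left (h₁.finslerDist_norm_le hst
        (fun τ hτ => hc τ ⟨hs.1.trans hτ.1, hτ.2.trans ht.2⟩) h₂) ha
    tfae_finish
  · by_contra! h
    exact GRDE.euclideanGauge_ne_smul_norm hn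
      ((GRDE.isSymmetricGauge_euclideanGauge n).eq_smul_norm_of_nonExpansive (k := k) h)
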